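/- Let $\mathbb{P}(\mathbb{R}^{3,3})$ be the projective space of $\mathbb{R}^6$ with homogeneous coordinates $(p_{01},p_{02},p_{03},p_{12},p_{13},p_{23})$, equipped with the quadratic form $p_{01}p_{23}-p_{02}p_{13}+p_{03}p_{12}$ of signature $(3,3)$. Its zero set is the Plücker quadric, whose points are the lines of $\mathbb{RP}^3$ via the Plücker coordinates $p_{ab}=x_ay_b-x_by_a$ of the line joining $[x]$ and $[y]$. A line contained in the Plücker quadric (an isotropic line) is the pencil of all lines of $\mathbb{RP}^3$ that pass through a point $x$ and lie in a plane $E\ni x$, and so represents the contact element $(x,E)$. A multi-line congruence in the Plücker quadric is a family $(\ell_{i,j})_{(i,j)\in\mathbb{Z}^2}$ of isotropic lines such that $\ell_{i_0,j_0}$ intersects $\ell_{i_1,j_0}$ and $\ell_{i_0,j_1}$ for all $i_0,i_1,j_0,j_1\in\mathbb{Z}$. **Theorem.** Let $(\ell_{i,j})_{(i,j)\in\mathbb{Z}^2}$ be a multi-line congruence in the Plücker quadric that is generic in the following sense: for every $j$ no three of the lines $\ell_{i,j}$ with distinct $i\in\mathbb{Z}$ lie in a common plane, for every $i$ no three of the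 lines $\ell_{i,j}$ with distinct $j\in\mathbb{Z}$ lie in a common plane, and the lines $\ell_{i,j}$, $(i,j)\in\mathbb{Z}^2$, do not all pass through one common point. Then there is a hyperboloid in $\mathbb{RP}^3$ (a nondegenerate doubly ruled quadric $\mathcal{Q}$, given by a quadratic form of signature $(2,2)$) such that every $\ell_{i,j}$ is a contact element of $\mathcal{Q}$, that is, $\ell_{i,j}$ is the pencil of lines of $\mathbb{RP}^3$ through a point $x_{i,j}\in\mathcal{Q}$ in the tangent plane of $\mathcal{Q}$ at $x_{i,j}$. -/

import Mathlib

/-- Homogeneous coordinates of points of `RP³`. -/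
abbrev PointSpace : Type := Fin 4 → ℝ

/-- Homogeneous coordinates `(p₀₁, p₀₂, p₀₃, p₁₂, p₁₃, p₂₃)` of points of the projective space
`P(ℝ^{3,3})`. A `d`-dimensional projective subspace is a linear subspace of dimension `d + 1`. -/
abbrev PluckerSpace : Type := Fin 6 → ℝ

/-- The quadratic form `p₀₁ p₂₃ - p₀₂ p₁₃ + p₀₃ p₁₂` of signature `(3,3)`, whose zero set is the
Plücker quadric. -/
noncomputable def pluckerForm : QuadraticForm ℝ PluckerSpace :=
  QuadraticMap.linMulLin (LinearMap.proj 0) (LinearMap.proj 5)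
    - QuadraticMap.linMulLin (LinearMap.proj 1) (LinearMap.proj 4)
    + QuadraticMap.linMulLin (LinearMap.proj 2) (LinearMap.proj 3)

/-- Plücker coordinates `p_{ab} = x_a y_b - x_b y_a` of the join of two points of `RP³`, as a
bilinear map. -/
def pluckerJoin : PointSpace →ₗ[ℝ] PointSpace →ₗ[ℝ] PluckerSpace :=
  LinearMap.mk₂ ℝ
    (fun x y => ![x 0 * y 1 - x 1 * y 0, x 0 * y 2 - x 2 * y 0, x 0 * y 3 - x 3 * y 0,
      x 1 * y 2 - x 2 * y 1, x 1 * y 3 - x 3 * y 1, x 2 * y 3 - x 3 * y 2])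
    (by intro x x' y; ext k; fin_cases k <;> simp <;> ring)
    (by intro c x y; ext k; fin_cases k <;> simp <;> ring)
    (by intro x y y'; ext k; fin_cases k <;> simp <;> ring)
    (by intro c x y; ext k; fin_cases k <;> simp <;> ring)

/-- The join of two points lies on the Plücker quadric. -/
theorem pluckerForm_pluckerJoin (x y : PointSpace) : pluckerForm (pluckerJoin x y) = 0 := by
  simp [pluckerForm, pluckerJoin]
  ring

/-- A projective line contained in the Plücker quadric (an isotropic line). -/
def IsIsotropicLine (L : Submodule ℝ PluckerSpace) : Prop :=
  Module.finrank ℝ L = 2 ∧ ∀ p ∈ L, pluckerForm p = 0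

/-- Two projective subspaces of `P(ℝ^{3,3})` have a common point. -/
def Intersect (L M : Submodule ℝ PluckerSpace) : Prop :=
  ∃ p : PluckerSpace, p ≠ 0 ∧ p ∈ L ∧ p ∈ M

/-- Three projective lines lie in a common projective plane. -/
def CoplanarLines (L M N : Submodule ℝ PluckerSpace) : Prop :=
  ∃ P : Submodule ℝ PluckerSpace, Module.finrank ℝ P = 3 ∧ L ≤ P ∧ M ≤ P ∧ N ≤ P

/-- A multi-line congruence in the Plücker quadric: a `ℤ²`-family of isotropic lines such that any
two lines belonging to the same parameter line intersect. -/
structure IsIsotropicMultiLineCongruence (l : ℤ → ℤ → Submodule ℝ PluckerSpace) : Prop where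
  isotropic : ∀ i j, IsIsotropicLine (l i j)
  intersect_fst : ∀ i₀ i₁ j₀, Intersect (l i₀ j₀) (l i₁ j₀)
  intersect_snd : ∀ i₀ j₀ j₁, Intersect (l i₀ j₀) (l i₀ j₁)

/-- General position of a `ℤ²`-family of lines: no three lines belonging to the same parameter line
are coplanar, and the lines of the whole family do not all pass through one common point. -/
structure IsGenericLineFamily (l : ℤ → ℤ → Submodule ℝ PluckerSpace) : Prop where
  not_coplanar_fst : ∀ i₀ i₁ i₂ j, i₀ ≠ i₁ → i₁ ≠ i₂ → i₀ ≠ i₂ →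
    ¬ CoplanarLines (l i₀ j) (l i₁ j) (l i₂ j)
  not_coplanar_snd : ∀ i j₀ j₁ j₂, j₀ ≠ j₁ → j₁ ≠ j₂ → j₀ ≠ j₂ →
    ¬ CoplanarLines (l i j₀) (l i j₁) (l i j₂)
  not_concurrent : ¬ ∃ p : PluckerSpace, p ≠ 0 ∧ ∀ i j, p ∈ l i j

/-- The projective quadric `Q = 0` in `RP³` is a hyperboloid, that is, a nondegenerate doubly ruled
quadric: the form `Q` has signature `(2,2)`. -/
def IsHyperboloid (Q : QuadraticForm ℝ PointSpace) : Prop :=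
  QuadraticMap.Equivalent Q (QuadraticMap.weightedSumSquares ℝ (![1, 1, -1, -1] : Fin 4 → ℝ))

/-- The tangent plane of the quadric `Q = 0` at its point `[x]`: all points conjugate to `[x]`. -/
def tangentPlane (Q : QuadraticForm ℝ PointSpace) (x : PointSpace) : Submodule ℝ PointSpace :=
  LinearMap.ker (Q.polarBilin x)

/-- The pencil of all lines of `RP³` that pass through the point `[x]` and lie in the plane `E`
(where `[x]` is a point of `E`), as a subspace of `P(ℝ^{3,3})`. This represents the contact element
`([x], E)`. -/
def contactElement (x : PointSpace) (E : Submodule ℝ PointSpace) : Submodule ℝ PluckerSpace :=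
  E.map (pluckerJoin x)

/-- `L` represents a contact element of the quadric `Q = 0`: a point of the quadric together with
the tangent plane there. -/
def IsContactElementOf (Q : QuadraticForm ℝ PointSpace) (L : Submodule ℝ PluckerSpace) : Prop :=
  ∃ x : PointSpace, x ≠ 0 ∧ Q x = 0 ∧ L = contactElement x (tangentPlane Q x)

open Module Submodule

/-!
Lines of the Plücker quadric that intersect pairwise are concurrent or coplanar. Hence for fixed `j`
all lines `l i j` pass through one point `a j` of the quadric, and for fixed `i` they all pass
through one point `b i` (`IsGenericCongruence.exists_vertex`). As `a j` and `b i` lie on a common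
isotropic line, they are conjugate. Genericity makes any three of the `a j` independent modulo each
`b i`, and vice versa. Therefore the `a j` and the `b i` span two polar planes of `P(ℝ^{3,3})`
(`IsGenericCongruence.span_eq_orthogonal`), the line `l i j` is the join of `a j` and `b i`, and
the plane of the `a j` meets the quadric in a conic with five points no three of which are collinear.
Such a conic is nondegenerate unless the plane is isotropic, that is, its own polar, which is
excluded; so distinct `a j` are never conjugate (`IsGenericCongruence.pluckerBilin_ne_zero`).

In `RP³` this means that the lines `a j` and the lines `b i` belong to two complementary reguli.
To obtain the quadric explicitly, `a 0`, `a 1`, `b 0`, `b 1` are taken as four edges of a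
tetrahedron (`exists_tetrahedron`), whose vertices are rescaled so that `a 2` has equal
coordinates on the two remaining edges. Conjugacy then shows that all `a j` and all `b i` are
given by the rational parametrizations of the two reguli of the hyperboloid `X₀ X₃ + X₁ X₂ = 0`
(`exists_basis_regulus`), and two lines, one of each regulus, span the contact element at their
point of intersection (`isContactElementOf_hyperboloidForm`).
-/

/-! ### Concurrent and coplanar lines -/

/-- Subspaces of dimension at most three extend to three-dimensional ones, so coplanarity only
bounds the dimension of the join. -/
theorem coplanarLines_of_finrank_le {L M N : Submodule ℝ PluckerSpace}
    (h : finrank ℝ ↥(L ⊔ M ⊔ N) ≤ 3) : CoplanarLines L M N := by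
  have key : ∀ k : ℕ, ∀ S : Submodule ℝ PluckerSpace, finrank ℝ S + k = 3 →
      ∃ P : Submodule ℝ PluckerSpace, finrank ℝ P = 3 ∧ S ≤ P := by
    intro k
    induction k with
    | zero => exact fun S hS => ⟨S, hS, le_rfl⟩
    | succ k ih =>
      intro S hS
      have hlt : S < ⊤ := by
        refine lt_top_iff_ne_top.2 fun h => ?_
        rw [h, finrank_top, finrank_fin_fun] at hS
        omega
      obtain ⟨v, -, hv⟩ := SetLike.exists_of_lt hlt
      have h1 : finrank ℝ S < finrank ℝ ↥(S ⊔ span ℝ {v}) :=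
        finrank_lt_finrank_of_lt (lt_of_le_of_ne le_sup_left fun h => hv <| by
          rw [h]
          exact mem_sup_right (mem_span_singleton_self v))
      have h2 := finrank_add_le_finrank_add_finrank S (span ℝ {v})
      have h3 := finrank_span_le_card (R := ℝ) ({v} : Set PluckerSpace)
      simp only [Set.toFinset_singleton, Finset.card_singleton] at h3
      obtain ⟨P, hP, hSP⟩ := ih (S ⊔ span ℝ {v}) (by omega)
      exact ⟨P, hP, le_sup_left.trans hSP⟩
  obtain ⟨P, hP, hle⟩ := key (3 - finrank ℝ ↥(L ⊔ M ⊔ N)) (L ⊔ M ⊔ N) (by omega)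
  exact ⟨P, hP, le_sup_left.trans (le_sup_left.trans hle),
    le_sup_right.trans (le_sup_left.trans hle), le_sup_right.trans hle⟩

theorem Intersect.symm {L M : Submodule ℝ PluckerSpace} (h : Intersect L M) : Intersect M L :=
  let ⟨p, h0, h1, h2⟩ := h
  ⟨p, h0, h2, h1⟩

theorem Intersect.one_le_finrank_inf {L M : Submodule ℝ PluckerSpace} (h : Intersect L M) :
    1 ≤ finrank ℝ ↥(L ⊓ M) := by
  obtain ⟨p, h0, h1, h2⟩ := h
  exact one_le_finrank_iff.2 ((Submodule.ne_bot_iff _).2 ⟨p, ⟨h1, h2⟩, h0⟩)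

/-- Two intersecting lines which are not coplanar with a third line meeting the first one are
distinct, hence meet in a single point. -/
theorem finrank_inf_of_not_coplanarLines {L M N : Submodule ℝ PluckerSpace}
    (hL : finrank ℝ L = 2) (hM : finrank ℝ M = 2) (hN : finrank ℝ N = 2)
    (hLM : Intersect L M) (hLN : Intersect L N) (h : ¬ CoplanarLines L M N) :
    finrank ℝ ↥(L ⊓ M) = 1 := by
  have h1 := hLM.one_le_finrank_inf
  have h2 : finrank ℝ ↥(L ⊓ M) ≤ 2 := hL ▸ finrank_mono inf_le_left
  by_contra hne
  have hLe : L ⊓ M = L := eq_of_le_of_finrank_eq inf_le_left (by omega)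
  have hMe : L ⊓ M = M := eq_of_le_of_finrank_eq inf_le_right (by omega)
  have hEq : M = L := hMe.symm.trans hLe
  refine h (coplanarLines_of_finrank_le ?_)
  rw [hEq, sup_idem]
  have h3 := finrank_sup_add_finrank_inf_eq L N
  have h4 := hLN.one_le_finrank_inf
  omega

/-- Three pairwise intersecting lines are coplanar or concurrent. -/
theorem mem_of_not_coplanarLines {L M N : Submodule ℝ PluckerSpace}
    (hL : finrank ℝ L = 2) (hM : finrank ℝ M = 2) (hN : finrank ℝ N = 2)
    (hLM : Intersect L M) (hLN : Intersect L N) (hMN : Intersect M N)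
    (h : ¬ CoplanarLines L M N) {p : PluckerSpace} (hp : p ∈ L ⊓ M) : p ∈ N := by
  have h1 := finrank_inf_of_not_coplanarLines hL hM hN hLM hLN h
  have h2 := finrank_sup_add_finrank_inf_eq L M
  have hNle : ¬ N ≤ L ⊔ M := fun hle => h <| coplanarLines_of_finrank_le <| by
    rw [sup_eq_left.2 hle]
    omega
  -- `N` meets the plane `L ⊔ M` in a single point, which therefore lies on both `L` and `M`.
  have h3 : finrank ℝ ↥(N ⊓ (L ⊔ M)) < 2 :=
    hN ▸ finrank_lt_finrank_of_lt (inf_lt_left.2 hNle)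
  have h4 := hLN.symm.one_le_finrank_inf
  have h5 := hMN.symm.one_le_finrank_inf
  have e1 : N ⊓ L = N ⊓ (L ⊔ M) := eq_of_le_of_finrank_le (inf_le_inf_left _ le_sup_left) (by omega)
  have e2 : N ⊓ M = N ⊓ (L ⊔ M) :=
    eq_of_le_of_finrank_le (inf_le_inf_left _ le_sup_right) (by omega)
  have e3 : N ⊓ L = L ⊓ M := eq_of_le_of_finrank_le
    (le_inf inf_le_right ((e1.trans e2.symm).le.trans inf_le_right)) (by omega)
  exact (e3.symm.le hp).1

/-- A generic isotropic multi-line congruence. The hypotheses are bundled because they are symmetric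
under exchanging the two parameter directions, so that every statement about the points `a j` also
holds for the points `b i`. -/
structure IsGenericCongruence (l : ℤ → ℤ → Submodule ℝ PluckerSpace) : Prop where
  congruence : IsIsotropicMultiLineCongruence l
  generic : IsGenericLineFamily l

namespace IsGenericCongruence

variable {l : ℤ → ℤ → Submodule ℝ PluckerSpace}

theorem swap (h : IsGenericCongruence l) : IsGenericCongruence fun i j => l j i where
  congruence :=
    { isotropic := fun i j => h.congruence.isotropic j i
      intersect_fst := fun i₀ i₁ j => h.congruence.intersect_snd j i₀ i₁
      intersect_snd := fun i j₀ j₁ => h.congruence.intersect_fst j₀ j₁ i }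
  generic :=
    { not_coplanar_fst := fun i₀ i₁ i₂ j => h.generic.not_coplanar_snd j i₀ i₁ i₂
      not_coplanar_snd := fun i j₀ j₁ j₂ => h.generic.not_coplanar_fst j₀ j₁ j₂ i
      not_concurrent := fun ⟨p, h0, hp⟩ => h.generic.not_concurrent ⟨p, h0, fun i j => hp j i⟩ }

/-- All lines with the same second index pass through a common point. -/
theorem exists_vertex (h : IsGenericCongruence l) (j : ℤ) :
    ∃ a : PluckerSpace, a ≠ 0 ∧ ∀ i, a ∈ l i j := by
  obtain ⟨a, h0, h1, h2⟩ := h.congruence.intersect_fst 0 1 j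
  refine ⟨a, h0, fun i => ?_⟩
  by_cases hi0 : i = 0
  · exact hi0 ▸ h1
  by_cases hi1 : i = 1
  · exact hi1 ▸ h2
  exact mem_of_not_coplanarLines (h.congruence.isotropic 0 j).1 (h.congruence.isotropic 1 j).1
    (h.congruence.isotropic i j).1 (h.congruence.intersect_fst _ _ _)
    (h.congruence.intersect_fst _ _ _) (h.congruence.intersect_fst _ _ _)
    (h.generic.not_coplanar_fst 0 1 i j (by decide) (Ne.symm hi1) (Ne.symm hi0)) ⟨h1, h2⟩

/-- Two different lines with the same second index have only one point in common. -/
theorem mem_span_of_mem_inf (h : IsGenericCongruence l) {i i' j : ℤ} (hi : i ≠ i')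
    {p q : PluckerSpace} (hp0 : p ≠ 0) (hp : p ∈ l i j ⊓ l i' j) (hq : q ∈ l i j ⊓ l i' j) :
    q ∈ span ℝ {p} := by
  obtain ⟨k, hk⟩ := Set.Finite.exists_notMem (Set.toFinite ({i, i'} : Set ℤ))
  simp only [Set.mem_insert_iff, Set.mem_singleton_iff, not_or] at hk
  have h1 := finrank_inf_of_not_coplanarLines (h.congruence.isotropic i j).1
    (h.congruence.isotropic i' j).1 (h.congruence.isotropic k j).1
    (h.congruence.intersect_fst _ _ _) (h.congruence.intersect_fst _ _ _)
    (h.generic.not_coplanar_fst i i' k j hi (Ne.symm hk.2) (Ne.symm hk.1))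
  have h2 : span ℝ {p} = l i j ⊓ l i' j := eq_of_le_of_finrank_le
    ((span_singleton_le_iff_mem _ _).2 hp) (by rw [finrank_span_singleton hp0, h1])
  exact h2 ▸ hq

end IsGenericCongruence

/-! ### The polar form of the Plücker quadric -/

/-- The bilinear form polar to `pluckerForm`. -/
noncomputable def pluckerBilin : LinearMap.BilinForm ℝ PluckerSpace := pluckerForm.polarBilin

theorem pluckerForm_apply (p : PluckerSpace) :
    pluckerForm p = p 0 * p 5 - p 1 * p 4 + p 2 * p 3 := by
  simp [pluckerForm]

theorem pluckerBilin_apply (p q : PluckerSpace) : pluckerBilin p q =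
    p 0 * q 5 + p 5 * q 0 - p 1 * q 4 - p 4 * q 1 + p 2 * q 3 + p 3 * q 2 := by
  simp only [pluckerBilin, QuadraticMap.polarBilin_apply_apply, QuadraticMap.polar,
    pluckerForm_apply, Pi.add_apply]
  ring

theorem pluckerBilin_comm (p q : PluckerSpace) : pluckerBilin p q = pluckerBilin q p := by
  simp only [pluckerBilin_apply]
  ring

theorem pluckerBilin_self (p : PluckerSpace) : pluckerBilin p p = 2 * pluckerForm p := by
  rw [pluckerBilin_apply, pluckerForm_apply]
  ring

theorem pluckerBilin_nondegenerate : pluckerBilin.Nondegenerate := by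
  have key : ∀ p : PluckerSpace, (∀ q, pluckerBilin p q = 0) → p = 0 := by
    intro p hp
    ext k
    fin_cases k
    · simpa [pluckerBilin_apply] using hp (Pi.single 5 1)
    · simpa [pluckerBilin_apply] using hp (Pi.single 4 1)
    · simpa [pluckerBilin_apply] using hp (Pi.single 3 1)
    · simpa [pluckerBilin_apply] using hp (Pi.single 2 1)
    · simpa [pluckerBilin_apply] using hp (Pi.single 1 1)
    · simpa [pluckerBilin_apply] using hp (Pi.single 0 1)
  exact ⟨key, fun p hp => key p fun q => pluckerBilin_comm p q ▸ hp q⟩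

theorem IsIsotropicLine.pluckerBilin_eq_zero {L : Submodule ℝ PluckerSpace}
    (hL : IsIsotropicLine L) {p q : PluckerSpace} (hp : p ∈ L) (hq : q ∈ L) :
    pluckerBilin p q = 0 := by
  rw [pluckerBilin, QuadraticMap.polarBilin_apply_apply, QuadraticMap.polar,
    hL.2 _ (L.add_mem hp hq), hL.2 _ hp, hL.2 _ hq]
  norm_num

/-! ### The planes spanned by the points of concurrency -/

namespace IsGenericCongruence

variable {l : ℤ → ℤ → Submodule ℝ PluckerSpace}

/-- If some `a j` and some other `a j'` coincided with the point `b i`, then every line of the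
family would pass through that point. -/
theorem index_unique (h : IsGenericCongruence l) {a b : ℤ → PluckerSpace}
    (ha0 : ∀ j, a j ≠ 0) (ha : ∀ i j, a j ∈ l i j) (hb0 : ∀ i, b i ≠ 0) (hb : ∀ i j, b i ∈ l i j)
    {i j j' : ℤ} (hj : a j ∈ span ℝ {b i}) (hj' : a j' ∈ span ℝ {b i}) : j = j' := by
  by_contra hne
  have key : ∀ j, a j ∈ span ℝ {b i} → ∀ i', b i ∈ l i' j := by
    intro j hj i'
    obtain ⟨c, hc⟩ := mem_span_singleton.1 hj
    have hc0 : c ≠ 0 := by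
      rintro rfl
      exact ha0 j (by rw [← hc, zero_smul])
    exact ((l i' j).smul_mem_iff hc0).1 (hc ▸ ha i' j)
  refine h.generic.not_concurrent ⟨b i, hb0 i, fun i' j'' => ?_⟩
  have hmem := h.swap.mem_span_of_mem_inf hne (hb0 i') ⟨hb i' j, hb i' j'⟩
    ⟨key j hj i', key j' hj' i'⟩
  exact (span_singleton_le_iff_mem _ _).2 (hb i' j'') hmem

theorem line_eq_span (h : IsGenericCongruence l) {i j : ℤ} {p q : PluckerSpace} (hq0 : q ≠ 0)
    (hp : p ∈ l i j) (hq : q ∈ l i j) (hpq : p ∉ span ℝ {q}) : l i j = span ℝ {q, p} := by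
  have hli : LinearIndependent ℝ ![q, p] :=
    (LinearIndependent.pair_iff' hq0).2 fun c hc => hpq (mem_span_singleton.2 ⟨c, hc⟩)
  have h2 := finrank_span_eq_card hli
  rw [Matrix.range_cons_cons_empty] at h2
  refine (eq_of_le_of_finrank_eq (span_le.2 ?_) ?_).symm
  · rintro x (rfl | rfl)
    exacts [hq, hp]
  · rw [h2, (h.congruence.isotropic i j).1, Fintype.card_fin]

theorem linearIndependent_of_notMem (h : IsGenericCongruence l) {a b : ℤ → PluckerSpace}
    (ha : ∀ i j, a j ∈ l i j) (hb0 : ∀ i, b i ≠ 0) (hb : ∀ i j, b i ∈ l i j) {i : ℤ}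
    {s : Fin 3 → ℤ} (hs : s.Injective) (hsi : ∀ k, a (s k) ∉ span ℝ {b i}) :
    LinearIndependent ℝ (Matrix.vecCons (b i) (a ∘ s)) := by
  rw [linearIndependent_iff_card_le_finrank_span, Fintype.card_fin, Set.finrank]
  by_contra! hlt
  have hle : ∀ k, l i (s k) ≤ span ℝ (Set.range (Matrix.vecCons (b i) (a ∘ s))) := by
    intro k
    rw [h.line_eq_span (hb0 i) (ha _ _) (hb i _) (hsi k)]
    refine span_mono ?_
    rintro x (rfl | rfl)
    exacts [⟨0, rfl⟩, ⟨k.succ, rfl⟩]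
  refine h.generic.not_coplanar_snd i (s 0) (s 1) (s 2) (hs.ne (by decide)) (hs.ne (by decide))
    (hs.ne (by decide)) (coplanarLines_of_finrank_le ?_)
  have := finrank_mono (sup_le (sup_le (hle 0) (hle 1)) (hle 2))
  omega

theorem finrank_span_vertices (h : IsGenericCongruence l) {a b : ℤ → PluckerSpace}
    (ha0 : ∀ j, a j ≠ 0) (ha : ∀ i j, a j ∈ l i j) (hb0 : ∀ i, b i ≠ 0) (hb : ∀ i j, b i ∈ l i j)
    (i : ℤ) : 3 ≤ finrank ℝ (span ℝ (Set.range a)) ∧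
      (b i ∈ span ℝ (Set.range a) → 4 ≤ finrank ℝ (span ℝ (Set.range a))) := by
  -- At most one of the points `a j` is equal to `b i`.
  obtain ⟨s, hs, hsi⟩ : ∃ s : Fin 3 → ℤ, s.Injective ∧ ∀ k, a (s k) ∉ span ℝ {b i} := by
    by_cases hex : ∃ j, a j ∈ span ℝ {b i}
    · obtain ⟨j, hj⟩ := hex
      refine ⟨fun k => j + 1 + k, fun k k' hk => ?_, fun k hk => ?_⟩
      · exact Fin.ext (by simpa using hk)
      · have : j = j + 1 + (k : ℤ) := h.index_unique ha0 ha hb0 hb hj hk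
        omega
    · push Not at hex
      exact ⟨fun k => (k : ℕ), fun k k' hk => Fin.ext (by simpa using hk), fun k => hex _⟩
  have hli := h.linearIndependent_of_notMem ha hb0 hb hs hsi
  have hmem : ∀ k, a (s k) ∈ span ℝ (Set.range a) := fun k => subset_span ⟨s k, rfl⟩
  constructor
  · have h3 : LinearIndependent ℝ (a ∘ s) := hli.comp Fin.succ (Fin.succ_injective 3)
    have h3' := finrank_span_eq_card h3
    rw [Fintype.card_fin] at h3'
    exact h3' ▸ finrank_mono (span_mono (Set.range_comp_subset_range s a))
  · intro hbi
    have h4 := finrank_span_eq_card hli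
    rw [Fintype.card_fin] at h4
    refine h4.symm.le.trans (finrank_mono (span_le.2 ?_))
    rintro x ⟨k, rfl⟩
    refine Fin.cases ?_ (fun k => ?_) k
    exacts [hbi, hmem k]

theorem pluckerBilin_eq_zero (h : IsGenericCongruence l) {a b : ℤ → PluckerSpace}
    (ha : ∀ i j, a j ∈ l i j) (hb : ∀ i j, b i ∈ l i j) (i j : ℤ) :
    pluckerBilin (b i) (a j) = 0 :=
  (h.congruence.isotropic i j).pluckerBilin_eq_zero (hb i j) (ha i j)

/-- The points `a j` and the points `b i` span complementary polar planes: the two spans are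
orthogonal and each has dimension at least three. -/
theorem span_eq_orthogonal (h : IsGenericCongruence l) {a b : ℤ → PluckerSpace}
    (ha0 : ∀ j, a j ≠ 0) (ha : ∀ i j, a j ∈ l i j) (hb0 : ∀ i, b i ≠ 0)
    (hb : ∀ i j, b i ∈ l i j) :
    finrank ℝ (span ℝ (Set.range a)) = 3 ∧
      span ℝ (Set.range a) = pluckerBilin.orthogonal (span ℝ (Set.range b)) := by
  have hA := (h.finrank_span_vertices ha0 ha hb0 hb 0).1
  have hB := (h.swap.finrank_span_vertices hb0 (fun i j => hb j i) ha0 (fun i j => ha j i) 0).1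
  have hle : span ℝ (Set.range a) ≤ pluckerBilin.orthogonal (span ℝ (Set.range b)) := by
    refine span_le.2 ?_
    rintro _ ⟨j, rfl⟩ y hy
    have hker : span ℝ (Set.range b) ≤ LinearMap.ker (pluckerBilin.flip (a j)) := by
      refine span_le.2 ?_
      rintro _ ⟨i, rfl⟩
      exact h.pluckerBilin_eq_zero ha hb i j
    exact hker hy
  have hO := LinearMap.BilinForm.finrank_orthogonal pluckerBilin_nondegenerate
    (span ℝ (Set.range b))
  rw [finrank_fin_fun] at hO
  have hm := finrank_mono hle
  exact ⟨by omega, eq_of_le_of_finrank_le hle (by omega)⟩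

theorem notMem_span (h : IsGenericCongruence l) {a b : ℤ → PluckerSpace}
    (ha0 : ∀ j, a j ≠ 0) (ha : ∀ i j, a j ∈ l i j) (hb0 : ∀ i, b i ≠ 0)
    (hb : ∀ i j, b i ∈ l i j) (i : ℤ) : b i ∉ span ℝ (Set.range a) := fun hi => by
  have h1 := (h.finrank_span_vertices ha0 ha hb0 hb i).2 hi
  have h2 := (h.span_eq_orthogonal ha0 ha hb0 hb).1
  omega

theorem notMem_span_singleton (h : IsGenericCongruence l) {a b : ℤ → PluckerSpace}
    (ha0 : ∀ j, a j ≠ 0) (ha : ∀ i j, a j ∈ l i j) (hb0 : ∀ i, b i ≠ 0)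
    (hb : ∀ i j, b i ∈ l i j) (i j : ℤ) : a j ∉ span ℝ {b i} := fun hj =>
  h.swap.notMem_span hb0 (fun i j => hb j i) ha0 (fun i j => ha j i) j
    (span_mono (Set.singleton_subset_iff.2 (Set.mem_range_self i)) hj)

/-- No three of the points `a j` are collinear. -/
theorem linearIndependent (h : IsGenericCongruence l) {a b : ℤ → PluckerSpace}
    (ha0 : ∀ j, a j ≠ 0) (ha : ∀ i j, a j ∈ l i j) (hb0 : ∀ i, b i ≠ 0)
    (hb : ∀ i j, b i ∈ l i j) {s : Fin 3 → ℤ} (hs : s.Injective) :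
    LinearIndependent ℝ (a ∘ s) :=
  (h.linearIndependent_of_notMem ha hb0 hb hs fun k =>
    h.notMem_span_singleton ha0 ha hb0 hb 0 (s k)).comp Fin.succ (Fin.succ_injective 3)

/-- Two different points `a j` are never conjugate. Indeed, the conic of isotropic points in their
plane carries five points no three of which are collinear, so it cannot contain a line unless it is
the whole plane; but then that plane would be its own polar. -/
theorem pluckerBilin_ne_zero (h : IsGenericCongruence l) {a b : ℤ → PluckerSpace}
    (ha0 : ∀ j, a j ≠ 0) (ha : ∀ i j, a j ∈ l i j) (hb0 : ∀ i, b i ≠ 0)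
    (hb : ∀ i j, b i ∈ l i j) {s : Fin 5 → ℤ} (hs : s.Injective) :
    pluckerBilin (a (s 0)) (a (s 1)) ≠ 0 := by
  intro h01
  have hind : ∀ i j k : Fin 5, i ≠ j → j ≠ k → i ≠ k → ∀ x y z : ℝ,
      x • a (s i) + y • a (s j) + z • a (s k) = 0 → x = 0 ∧ y = 0 ∧ z = 0 := by
    intro i j k hij hjk hik x y z hxyz
    have hinj : Function.Injective ![i, j, k] := by
      intro m n hmn
      fin_cases m <;> fin_cases n <;> simp_all
    have := Fintype.linearIndependent_iff.1
      (h.linearIndependent ha0 ha hb0 hb (hs.comp hinj)) ![x, y, z]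
      (by simpa [Fin.sum_univ_three] using hxyz)
    exact ⟨this 0, this 1, this 2⟩
  have hli : LinearIndependent ℝ ![a (s 0), a (s 1), a (s 2)] := by
    rw [Fintype.linearIndependent_iff]
    intro g hg
    obtain ⟨h0, h1, h2⟩ := hind 0 1 2 (by decide) (by decide) (by decide) (g 0) (g 1) (g 2)
      (by simpa [Fin.sum_univ_three] using hg)
    intro k
    fin_cases k
    exacts [h0, h1, h2]
  obtain ⟨hA, hort⟩ := h.span_eq_orthogonal ha0 ha hb0 hb
  have hspan : span ℝ {a (s 0), a (s 1), a (s 2)} = span ℝ (Set.range a) := by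
    have h3 := finrank_span_eq_card hli
    have hr : Set.range ![a (s 0), a (s 1), a (s 2)] = {a (s 0), a (s 1), a (s 2)} := by
      rw [Matrix.range_cons, Matrix.range_cons_cons_empty]
      rfl
    rw [hr, Fintype.card_fin] at h3
    refine eq_of_le_of_finrank_eq (span_le.2 ?_) (by omega)
    rintro x (rfl | rfl | rfl) <;> exact subset_span ⟨_, rfl⟩
  have hself : ∀ j, pluckerBilin (a j) (a j) = 0 := fun j =>
    (h.congruence.isotropic 0 j).pluckerBilin_eq_zero (ha 0 j) (ha 0 j)
  have hcomb : ∀ k : Fin 5, k ≠ 0 → k ≠ 1 → k ≠ 2 → ∃ x y z : ℝ,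
      x • a (s 0) + y • a (s 1) + z • a (s 2) = a (s k) ∧ x ≠ 0 ∧
      x * pluckerBilin (a (s 0)) (a (s 2)) + y * pluckerBilin (a (s 1)) (a (s 2)) = 0 := by
    intro k hk0 hk1 hk2
    have hmem : a (s k) ∈ span ℝ {a (s 0), a (s 1), a (s 2)} := hspan ▸ subset_span ⟨_, rfl⟩
    obtain ⟨x, y, z, hxyz⟩ := mem_span_triple.1 hmem
    have hx : x ≠ 0 := by
      rintro rfl
      have := (hind 1 2 k (by decide) hk2.symm hk1.symm y z (-1) (by rw [← hxyz]; module)).2.2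
      norm_num at this
    have hz : z ≠ 0 := by
      rintro rfl
      have := (hind 0 1 k (by decide) hk1.symm hk0.symm x y (-1) (by rw [← hxyz]; module)).2.2
      norm_num at this
    refine ⟨x, y, z, hxyz, hx, mul_left_cancel₀ hz ?_⟩
    have hq := hself (s k)
    rw [← hxyz] at hq
    simp only [map_add, map_smul, LinearMap.add_apply, LinearMap.smul_apply, smul_eq_mul, hself,
      pluckerBilin_comm (a (s 1)) (a (s 0)), h01, pluckerBilin_comm (a (s 2)) (a (s 0)),
      pluckerBilin_comm (a (s 2)) (a (s 1))] at hq
    linear_combination hq / 2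
  obtain ⟨x, y, z, h3, hx, e3⟩ := hcomb 3 (by decide) (by decide) (by decide)
  obtain ⟨x', y', z', h4, hx', e4⟩ := hcomb 4 (by decide) (by decide) (by decide)
  -- If `(x, y)` and `(x', y')` were proportional, then `a (s 2)`, `a (s 3)`, `a (s 4)` would be
  -- collinear.
  have hdet : x * y' - x' * y ≠ 0 := by
    intro hd
    refine hx' (hind 3 4 2 (by decide) (by decide) (by decide) x' (-x) (x * z' - x' * z) ?_).1
    rw [← h3, ← h4]
    trans -((x * y' - x' * y) • a (s 1))
    · module
    · rw [hd, zero_smul, neg_zero]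
  have h12 : pluckerBilin (a (s 1)) (a (s 2)) = 0 :=
    (mul_eq_zero.1 (show (x * y' - x' * y) * pluckerBilin (a (s 1)) (a (s 2)) = 0 by
      linear_combination x * e4 - x' * e3)).resolve_left hdet
  have h02 : pluckerBilin (a (s 0)) (a (s 2)) = 0 :=
    (mul_eq_zero.1 (show x * pluckerBilin (a (s 0)) (a (s 2)) = 0 by
      linear_combination e3 - y * h12)).resolve_left hx
  have hle : span ℝ (Set.range a) ≤ pluckerBilin.orthogonal (span ℝ (Set.range a)) := by
    rw [← hspan]
    refine span_le.2 ?_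
    intro u hu v hv
    obtain ⟨x, y, z, rfl⟩ := mem_span_triple.1 hv
    rcases hu with rfl | rfl | rfl <;>
    simp [hself, h01, h12, h02, pluckerBilin_comm (a (s 1)) (a (s 0)),
      pluckerBilin_comm (a (s 2)) (a (s 0)), pluckerBilin_comm (a (s 2)) (a (s 1))]
  obtain ⟨hB, hort'⟩ :=
    h.swap.span_eq_orthogonal hb0 (fun i j => hb j i) ha0 (fun i j => ha j i)
  have heq : span ℝ (Set.range a) = span ℝ (Set.range b) :=
    eq_of_le_of_finrank_eq (hle.trans hort'.symm.le) (by omega)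
  exact h.notMem_span ha0 ha hb0 hb 0 (heq ▸ subset_span ⟨0, rfl⟩)

end IsGenericCongruence

/-! ### Lines of `RP³` and their Plücker coordinates -/

theorem pluckerJoin_self (x : PointSpace) : pluckerJoin x x = 0 := by
  ext k
  fin_cases k <;> simp [pluckerJoin] <;> ring

theorem pluckerJoin_comm (x y : PointSpace) : pluckerJoin y x = -pluckerJoin x y := by
  ext k
  fin_cases k <;> simp [pluckerJoin] <;> ring

/-- Every point of the Plücker quadric is a line of `RP³`: the columns of the skew matrix of its
coordinates are points of that line, and two of them span it. -/
theorem exists_eq_pluckerJoin {p : PluckerSpace} (hp : pluckerForm p = 0) :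
    ∃ x y, p = pluckerJoin x y := by
  rw [pluckerForm_apply] at hp
  have key : ∀ (c : ℝ) (x y : PointSpace), c ≠ 0 → c • p = pluckerJoin x y →
      ∃ x y, p = pluckerJoin x y := fun c x y hc h =>
    ⟨c⁻¹ • x, y, by rw [map_smul, LinearMap.smul_apply, ← h, inv_smul_smul₀ hc]⟩
  let r0 : PointSpace := ![0, p 0, p 1, p 2]
  let r1 : PointSpace := ![-p 0, 0, p 3, p 4]
  let r2 : PointSpace := ![-p 1, -p 3, 0, p 5]
  let r3 : PointSpace := ![-p 2, -p 4, -p 5, 0]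
  by_contra hne
  have h0 : p 0 = 0 := by
    by_contra h
    refine hne (key (p 0) r0 r1 h ?_)
    ext k
    fin_cases k <;> simp [pluckerJoin, r0, r1] <;>
      first | ring1 | linear_combination hp
  have h1 : p 1 = 0 := by
    by_contra h
    refine hne (key (p 1) r0 r2 h ?_)
    ext k
    fin_cases k <;> simp [pluckerJoin, r0, r2] <;>
      first | ring1 | linear_combination hp | linear_combination -hp
  have h2 : p 2 = 0 := by
    by_contra h
    refine hne (key (p 2) r0 r3 h ?_)
    ext k
    fin_cases k <;> simp [pluckerJoin, r0, r3] <;>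
      first | ring1 | linear_combination hp
  have h3 : p 3 = 0 := by
    by_contra h
    refine hne (key (p 3) r1 r2 h ?_)
    ext k
    fin_cases k <;> simp [pluckerJoin, r1, r2] <;>
      first | ring1 | linear_combination hp
  have h4 : p 4 = 0 := by
    by_contra h
    refine hne (key (p 4) r1 r3 h ?_)
    ext k
    fin_cases k <;> simp [pluckerJoin, r1, r3] <;>
      first | ring1 | linear_combination hp | linear_combination -hp
  have h5 : p 5 = 0 := by
    by_contra h
    refine hne (key (p 5) r2 r3 h ?_)
    ext k
    fin_cases k <;> simp [pluckerJoin, r2, r3] <;>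
      first | ring1 | linear_combination hp
  refine hne ⟨0, 0, ?_⟩
  ext k
  fin_cases k <;> simp [h0, h1, h2, h3, h4, h5]

theorem pluckerBilin_pluckerJoin (f : Fin 4 → PointSpace) :
    pluckerBilin (pluckerJoin (f 0) (f 1)) (pluckerJoin (f 2) (f 3)) = (Matrix.of f).det := by
  simp [pluckerBilin_apply, pluckerJoin, Matrix.det_succ_row_zero, Fin.sum_univ_succ, Fin.succAbove]
  ring

theorem pluckerBilin_pluckerJoin_left (x y z : PointSpace) :
    pluckerBilin (pluckerJoin x y) (pluckerJoin x z) = 0 := by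
  simp [pluckerBilin_apply, pluckerJoin]
  ring

theorem pluckerBilin_pluckerJoin_right (x y z : PointSpace) :
    pluckerBilin (pluckerJoin y x) (pluckerJoin z x) = 0 := by
  simp [pluckerBilin_apply, pluckerJoin]
  ring

theorem pluckerBilin_pluckerJoin_mid (x y z : PointSpace) :
    pluckerBilin (pluckerJoin y x) (pluckerJoin x z) = 0 := by
  simp [pluckerBilin_apply, pluckerJoin]
  ring

theorem pluckerBilin_pluckerJoin_mid' (x y z : PointSpace) :
    pluckerBilin (pluckerJoin x y) (pluckerJoin z x) = 0 := by
  simp [pluckerBilin_apply, pluckerJoin]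
  ring

theorem pluckerBilin_pluckerJoin_swap (x y z w : PointSpace) :
    pluckerBilin (pluckerJoin x z) (pluckerJoin y w) =
      -pluckerBilin (pluckerJoin x y) (pluckerJoin z w) := by
  simp [pluckerBilin_apply, pluckerJoin]
  ring

theorem pluckerBilin_pluckerJoin_rotate (x y z w : PointSpace) :
    pluckerBilin (pluckerJoin x w) (pluckerJoin y z) =
      pluckerBilin (pluckerJoin x y) (pluckerJoin z w) := by
  simp [pluckerBilin_apply, pluckerJoin]
  ring

theorem linearIndependent_of_pluckerBilin_ne_zero {f : Fin 4 → PointSpace}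
    (hf : pluckerBilin (pluckerJoin (f 0) (f 1)) (pluckerJoin (f 2) (f 3)) ≠ 0) :
    LinearIndependent ℝ f := by
  rw [pluckerBilin_pluckerJoin] at hf
  exact Matrix.linearIndependent_rows_of_det_ne_zero hf

/-- Conjugate points of the Plücker quadric are intersecting lines of `RP³`. -/
theorem exists_eq_pluckerJoin_of_conjugate {u v : PointSpace} {b : PluckerSpace}
    (huv : pluckerJoin u v ≠ 0) (hb : pluckerForm b = 0)
    (h : pluckerBilin (pluckerJoin u v) b = 0) :
    ∃ (α β : ℝ) (z : PointSpace), b = pluckerJoin (α • u + β • v) z := by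
  obtain ⟨u', v', rfl⟩ := exists_eq_pluckerJoin hb
  have hdet : (Matrix.of ![u, v, u', v']).det = 0 := by
    rw [← pluckerBilin_pluckerJoin]
    exact h
  obtain ⟨c, hc0, hc⟩ := Matrix.exists_vecMul_eq_zero_iff.2 hdet
  have hc' : c 0 • u + c 1 • v + c 2 • u' + c 3 • v' = 0 := by
    rw [Matrix.vecMul_eq_sum] at hc
    rw [Fin.sum_univ_four] at hc
    exact hc
  have hx : c 2 • u' + c 3 • v' = (-c 0) • u + (-c 1) • v := by
    rw [← sub_eq_zero, ← hc']
    module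
  by_cases h2 : c 2 = 0
  · by_cases h3 : c 3 = 0
    · -- In this case `u` and `v` would be linearly dependent.
      exfalso
      have h01 : c 0 • u + c 1 • v = 0 := by simpa [h2, h3] using hc'
      have e0 : c 0 • pluckerJoin u v = 0 := by
        have := congrArg (fun x => pluckerJoin x v) h01
        simpa [pluckerJoin_self] using this
      have e1 : c 1 • pluckerJoin u v = 0 := by
        have := congrArg (fun x => pluckerJoin u x) h01
        simpa [pluckerJoin_self] using this
      refine hc0 (funext fun k => ?_)
      fin_cases k
      exacts [(smul_eq_zero.1 e0).resolve_right huv, (smul_eq_zero.1 e1).resolve_right huv, h2, h3]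
    · refine ⟨-c 0, -c 1, -(c 3)⁻¹ • u', ?_⟩
      rw [← hx]
      simp [pluckerJoin_self, pluckerJoin_comm u' v', h3]
  · refine ⟨-c 0, -c 1, (c 2)⁻¹ • v', ?_⟩
    rw [← hx]
    simp [pluckerJoin_self, h2]

/-- Four lines `a₀`, `a₁`, `b₀`, `b₁` of `RP³` such that each `aⱼ` meets each `bᵢ`, but neither the
`aⱼ` nor the `bᵢ` meet each other, are edges of a tetrahedron. -/
theorem exists_tetrahedron {a₀ a₁ b₀ b₁ : PluckerSpace} (ha₀ : pluckerForm a₀ = 0)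
    (ha₁ : pluckerForm a₁ = 0) (hb₀ : pluckerForm b₀ = 0) (hb₁ : pluckerForm b₁ = 0)
    (h00 : pluckerBilin b₀ a₀ = 0) (h01 : pluckerBilin b₀ a₁ = 0) (h10 : pluckerBilin b₁ a₀ = 0)
    (h11 : pluckerBilin b₁ a₁ = 0) (ha : pluckerBilin a₀ a₁ ≠ 0) (hb : pluckerBilin b₀ b₁ ≠ 0) :
    ∃ (f : Fin 4 → PointSpace) (c d : ℝ), pluckerJoin (f 0) (f 1) = c • a₀ ∧
      pluckerJoin (f 2) (f 3) = d • a₁ ∧ pluckerJoin (f 0) (f 2) = b₀ ∧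
      pluckerJoin (f 1) (f 3) = b₁ ∧
      pluckerBilin (pluckerJoin (f 0) (f 1)) (pluckerJoin (f 2) (f 3)) ≠ 0 := by
  obtain ⟨u, v, rfl⟩ := exists_eq_pluckerJoin ha₀
  obtain ⟨y, y', rfl⟩ := exists_eq_pluckerJoin ha₁
  have huv : pluckerJoin u v ≠ 0 := fun h => ha (by rw [h, map_zero, LinearMap.zero_apply])
  have hli : LinearIndependent ℝ ![u, v, y, y'] := linearIndependent_of_pluckerBilin_ne_zero ha
  have hspan : ∀ z : PointSpace, ∃ c : Fin 4 → ℝ, z = c 0 • u + c 1 • v + c 2 • y + c 3 • y' := by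
    intro z
    let B := basisOfLinearIndependentOfCardEqFinrank hli (by simp)
    refine ⟨B.repr z, ?_⟩
    have := B.sum_repr z
    simpa [B, Fin.sum_univ_four] using this.symm
  -- A line that meets the line `u v` at `α u + β v` and also meets the line `y y'`.
  have key : ∀ b : PluckerSpace, pluckerForm b = 0 → pluckerBilin b (pluckerJoin u v) = 0 →
      pluckerBilin b (pluckerJoin y y') = 0 → ∃ α β γ δ : ℝ,
        b = pluckerJoin (α • u + β • v) (γ • y + δ • y') := by
    intro b hb h0 h1
    obtain ⟨α, β, z, rfl⟩ :=
      exists_eq_pluckerJoin_of_conjugate huv hb (by rw [pluckerBilin_comm, h0])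
    obtain ⟨c, rfl⟩ := hspan z
    have hb' : pluckerJoin (α • u + β • v) (c 0 • u + c 1 • v + c 2 • y + c 3 • y') =
        (α * c 1 - β * c 0) • pluckerJoin u v +
          pluckerJoin (α • u + β • v) (c 2 • y + c 3 • y') := by
      simp only [map_add, map_smul, LinearMap.add_apply, LinearMap.smul_apply, pluckerJoin_self,
        pluckerJoin_comm u v]
      module
    refine ⟨α, β, c 2, c 3, ?_⟩
    rw [hb'] at h1 ⊢
    simp only [map_add, map_smul, LinearMap.add_apply, LinearMap.smul_apply, smul_eq_mul,
      pluckerBilin_pluckerJoin_right, pluckerBilin_pluckerJoin_mid, mul_zero, add_zero] at h1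
    rw [(mul_eq_zero.1 h1).resolve_right ha, zero_smul, zero_add]
  obtain ⟨α, β, γ, δ, rfl⟩ := key b₀ hb₀ h00 h01
  obtain ⟨α', β', γ', δ', rfl⟩ := key b₁ hb₁ h10 h11
  have e0 : pluckerJoin (α • u + β • v) (α' • u + β' • v) =
      (α * β' - β * α') • pluckerJoin u v := by
    simp only [map_add, map_smul, LinearMap.add_apply, LinearMap.smul_apply, pluckerJoin_self,
      pluckerJoin_comm u v]
    module
  have e1 : pluckerJoin (γ • y + δ • y') (γ' • y + δ' • y') =
      (γ * δ' - δ * γ') • pluckerJoin y y' := by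
    simp only [map_add, map_smul, LinearMap.add_apply, LinearMap.smul_apply, pluckerJoin_self,
      pluckerJoin_comm y y']
    module
  refine ⟨![α • u + β • v, α' • u + β' • v, γ • y + δ • y', γ' • y + δ' • y'], _, _, e0, e1, rfl,
    rfl, ?_⟩
  rw [pluckerBilin_pluckerJoin_swap, neg_ne_zero] at hb
  exact hb

/-! ### Reguli -/

/-- The six edges of a tetrahedron `x y z w` form a basis of the space of Plücker coordinates. The
points conjugate to the opposite edges `x z` and `y w` are combinations of the other four edges. -/
theorem exists_edge_coordinates {x y z w : PointSpace}
    (hD : pluckerBilin (pluckerJoin x y) (pluckerJoin z w) ≠ 0) {p : PluckerSpace}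
    (hp : pluckerForm p = 0) (h₁ : pluckerBilin p (pluckerJoin x z) = 0)
    (h₂ : pluckerBilin p (pluckerJoin y w) = 0) :
    ∃ s α β t : ℝ, p = s • pluckerJoin x y + α • pluckerJoin x w + β • pluckerJoin y z +
      t • pluckerJoin z w ∧ s * t + α * β = 0 := by
  let v : Fin 6 → PluckerSpace := ![pluckerJoin x y, pluckerJoin x z, pluckerJoin x w,
    pluckerJoin y z, pluckerJoin y w, pluckerJoin z w]
  -- The only pairs of edges that are not conjugate are the opposite ones.
  have hv : ∀ c : Fin 6 → ℝ, ∀ q : PluckerSpace, ∑ k, c k • v k = q →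
      pluckerBilin q (pluckerJoin x y) = c 5 * pluckerBilin (pluckerJoin x y) (pluckerJoin z w) ∧
      pluckerBilin q (pluckerJoin x z) = -c 4 * pluckerBilin (pluckerJoin x y) (pluckerJoin z w) ∧
      pluckerBilin q (pluckerJoin x w) = c 3 * pluckerBilin (pluckerJoin x y) (pluckerJoin z w) ∧
      pluckerBilin q (pluckerJoin y z) = c 2 * pluckerBilin (pluckerJoin x y) (pluckerJoin z w) ∧
      pluckerBilin q (pluckerJoin y w) = -c 1 * pluckerBilin (pluckerJoin x y) (pluckerJoin z w) ∧
      pluckerBilin q (pluckerJoin z w) =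
        c 0 * pluckerBilin (pluckerJoin x y) (pluckerJoin z w) := by
    rintro c q rfl
    have e : ∑ k, c k • v k = c 0 • pluckerJoin x y + c 1 • pluckerJoin x z +
        c 2 • pluckerJoin x w + c 3 • pluckerJoin y z + c 4 • pluckerJoin y w +
        c 5 • pluckerJoin z w := Fin.sum_univ_six _
    rw [e]
    refine ⟨?_, ?_, ?_, ?_, ?_, ?_⟩ <;>
    simp only [map_add, map_smul, LinearMap.add_apply, LinearMap.smul_apply, smul_eq_mul,
      pluckerBilin_pluckerJoin_left, pluckerBilin_pluckerJoin_right, pluckerBilin_pluckerJoin_mid,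
      pluckerBilin_pluckerJoin_mid', pluckerBilin_pluckerJoin_rotate x y z w,
      pluckerBilin_pluckerJoin_swap x y z w, pluckerBilin_comm (pluckerJoin z w) (pluckerJoin x y),
      pluckerBilin_comm (pluckerJoin y w) (pluckerJoin x z),
      pluckerBilin_comm (pluckerJoin y z) (pluckerJoin x w)] <;> ring
  have hli : LinearIndependent ℝ v := by
    rw [Fintype.linearIndependent_iff]
    intro c hc
    obtain ⟨e5, e4, e3, e2, e1, e0⟩ := hv c 0 hc
    simp only [map_zero, LinearMap.zero_apply, zero_eq_mul, hD, or_false, neg_eq_zero] at *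
    intro k
    fin_cases k <;> assumption
  let B := basisOfLinearIndependentOfCardEqFinrank hli (by simp)
  have hB : ∑ k, B.repr p k • v k = p := by simpa [B] using B.sum_repr p
  obtain ⟨e5, e4, e3, e2, e1, e0⟩ := hv _ p hB
  rw [h₁, zero_eq_mul, neg_eq_zero] at e4
  rw [h₂, zero_eq_mul, neg_eq_zero] at e1
  have hp' : p = B.repr p 0 • pluckerJoin x y + B.repr p 2 • pluckerJoin x w +
      B.repr p 3 • pluckerJoin y z + B.repr p 5 • pluckerJoin z w := by
    conv_lhs => rw [← hB]
    rw [Fin.sum_univ_six, e4.resolve_right hD, e1.resolve_right hD, zero_smul, zero_smul, add_zero,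
      add_zero]
    rfl
  refine ⟨_, _, _, _, hp', ?_⟩
  have hq := congrArg (pluckerBilin p) hp'
  simp only [map_add, map_smul, smul_eq_mul, pluckerBilin_self, hp, e0, e2, e3, e5] at hq
  refine (mul_eq_zero.1 ?_).resolve_right hD
  linear_combination -hq / 2

/-- A third line which meets the edges `x z` and `y w` of a tetrahedron, but not the edges `x y` and
`z w`, has nonzero coordinates on the two remaining edges `x w` and `y z`. -/
theorem exists_edge_coordinates_ne_zero {x y z w : PointSpace}
    (hD : pluckerBilin (pluckerJoin x y) (pluckerJoin z w) ≠ 0) {p : PluckerSpace}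
    (hp : pluckerForm p = 0) (h₁ : pluckerBilin p (pluckerJoin x z) = 0)
    (h₂ : pluckerBilin p (pluckerJoin y w) = 0) (h₃ : pluckerBilin p (pluckerJoin x y) ≠ 0)
    (h₄ : pluckerBilin p (pluckerJoin z w) ≠ 0) :
    ∃ s α β t : ℝ, p = s • pluckerJoin x y + α • pluckerJoin x w + β • pluckerJoin y z +
      t • pluckerJoin z w ∧ α ≠ 0 ∧ β ≠ 0 := by
  obtain ⟨s, α, β, t, rfl, h⟩ := exists_edge_coordinates hD hp h₁ h₂
  simp only [map_add, map_smul, LinearMap.add_apply, LinearMap.smul_apply, smul_eq_mul,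
    pluckerBilin_pluckerJoin_left, pluckerBilin_pluckerJoin_right, pluckerBilin_pluckerJoin_mid,
    pluckerBilin_pluckerJoin_mid', mul_zero, zero_add, add_zero] at h₃ h₄
  have hst : s * t ≠ 0 := mul_ne_zero (left_ne_zero_of_mul h₄) (left_ne_zero_of_mul h₃)
  have hab : α * β ≠ 0 := fun h0 => hst (by linear_combination h - h0)
  exact ⟨s, α, β, t, rfl, left_ne_zero_of_mul hab, right_ne_zero_of_mul hab⟩

/-- The conic of points of the Plücker quadric conjugate to `x z`, `y w` and `x w - y z` is a
regulus, and this is its rational parametrization. -/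
theorem exists_regulus_parameter {x y z w : PointSpace}
    (hD : pluckerBilin (pluckerJoin x y) (pluckerJoin z w) ≠ 0) {p : PluckerSpace}
    (hp : pluckerForm p = 0) (h₁ : pluckerBilin p (pluckerJoin x z) = 0)
    (h₂ : pluckerBilin p (pluckerJoin y w) = 0)
    (h₃ : pluckerBilin p (pluckerJoin x w - pluckerJoin y z) = 0) :
    ∃ c μ ν : ℝ, (μ ≠ 0 ∨ ν ≠ 0) ∧
      p = c • pluckerJoin (μ • x + ν • z) (μ • y - ν • w) := by
  obtain ⟨s, α, β, t, rfl, h⟩ := exists_edge_coordinates hD hp h₁ h₂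
  simp only [map_add, map_sub, map_smul, LinearMap.add_apply, LinearMap.smul_apply, smul_eq_mul,
    pluckerBilin_pluckerJoin_left, pluckerBilin_pluckerJoin_right, pluckerBilin_pluckerJoin_mid,
    pluckerBilin_pluckerJoin_mid', mul_zero, zero_add, add_zero,
    pluckerBilin_pluckerJoin_rotate x y z w, pluckerBilin_comm (pluckerJoin y z) (pluckerJoin x w)]
    at h₃
  obtain rfl : α = β := sub_eq_zero.1 <| (mul_eq_zero.1
    (show (α - β) * pluckerBilin (pluckerJoin x y) (pluckerJoin z w) = 0 by
      linear_combination -h₃)).resolve_right hD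
  by_cases hs : s = 0
  · have hα : α = 0 := by simpa [hs] using h
    refine ⟨-t, 0, 1, Or.inr one_ne_zero, ?_⟩
    simp [hs, hα]
  · refine ⟨s, 1, -(α / s), Or.inl one_ne_zero, ?_⟩
    have ht : t = -(α * α / s) := by
      field_simp
      linear_combination h
    simp only [map_add, map_sub, map_smul, LinearMap.add_apply, LinearMap.smul_apply,
      pluckerJoin_comm y z, ht]
    match_scalars <;> field_simp

/-! ### Contact elements of a hyperboloid -/

/-- The quadric `X₀ X₃ + X₁ X₂ = 0` in the homogeneous coordinates given by a basis. -/
noncomputable def hyperboloidForm (B : Basis (Fin 4) ℝ PointSpace) : QuadraticForm ℝ PointSpace :=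
  QuadraticMap.linMulLin (B.coord 0) (B.coord 3) + QuadraticMap.linMulLin (B.coord 1) (B.coord 2)

theorem hyperboloidForm_apply (B : Basis (Fin 4) ℝ PointSpace) (x : PointSpace) :
    hyperboloidForm B x = B.repr x 0 * B.repr x 3 + B.repr x 1 * B.repr x 2 := rfl

theorem polarBilin_hyperboloidForm (B : Basis (Fin 4) ℝ PointSpace) (x y : PointSpace) :
    (hyperboloidForm B).polarBilin x y = B.repr x 0 * B.repr y 3 + B.repr x 3 * B.repr y 0 +
      B.repr x 1 * B.repr y 2 + B.repr x 2 * B.repr y 1 := by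
  simp only [QuadraticMap.polarBilin_apply_apply, QuadraticMap.polar, hyperboloidForm_apply,
    map_add, Finsupp.add_apply]
  ring

theorem isHyperboloid_hyperboloidForm (B : Basis (Fin 4) ℝ PointSpace) :
    IsHyperboloid (hyperboloidForm B) := by
  -- `u v = ((u + v) / 2)² - ((u - v) / 2)²`
  let e : (Fin 4 → ℝ) ≃ₗ[ℝ] (Fin 4 → ℝ) :=
    { toFun := fun c => ![(c 0 + c 3) / 2, (c 1 + c 2) / 2, (c 0 - c 3) / 2, (c 1 - c 2) / 2]
      invFun := fun c => ![c 0 + c 2, c 1 + c 3, c 1 - c 3, c 0 - c 2]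
      map_add' := by
        intro c d
        ext k
        fin_cases k <;> simp <;> ring
      map_smul' := by
        intro r c
        ext k
        fin_cases k <;> simp <;> ring
      left_inv := by
        intro c
        ext k
        fin_cases k <;> simp <;> ring
      right_inv := by
        intro c
        ext k
        fin_cases k <;> simp }
  refine ⟨{ toLinearEquiv := B.equivFun.trans e, map_app' := fun x => ?_ }⟩
  simp [e, QuadraticMap.weightedSumSquares_apply, hyperboloidForm_apply, Fin.sum_univ_four]
  ring

/-- A line of the first regulus of `hyperboloidForm B` and a line of the second one span the contact
element at their point of intersection. -/
theorem isContactElementOf_hyperboloidForm (B : Basis (Fin 4) ℝ PointSpace)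
    {L : Submodule ℝ PluckerSpace} (hL : finrank ℝ L = 2) {c d μ ν μ' ν' : ℝ}
    (hμ : μ ≠ 0 ∨ ν ≠ 0) (hμ' : μ' ≠ 0 ∨ ν' ≠ 0)
    (h : L = span ℝ {c • pluckerJoin (μ • B 0 + ν • B 2) (μ • B 1 - ν • B 3),
      d • pluckerJoin (μ' • B 0 + ν' • B 1) (μ' • B 2 - ν' • B 3)}) :
    IsContactElementOf (hyperboloidForm B) L := by
  set A₁ := μ • B 0 + ν • B 2 with hA₁
  set A₂ := μ • B 1 - ν • B 3 with hA₂
  set C₁ := μ' • B 0 + ν' • B 1 with hC₁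
  set C₂ := μ' • B 2 - ν' • B 3 with hC₂
  set x := μ' • A₁ + ν' • A₂ with hx
  have hx' : x = μ • C₁ + ν • C₂ := by
    rw [hx, hA₁, hA₂, hC₁, hC₂]
    module
  have c0 : B.repr x 0 = μ * μ' := by simp [hx, hA₁, hA₂, mul_comm]
  have c1 : B.repr x 1 = μ * ν' := by simp [hx, hA₁, hA₂, mul_comm]
  have c2 : B.repr x 2 = ν * μ' := by simp [hx, hA₁, hA₂, mul_comm]
  have c3 : B.repr x 3 = -(ν * ν') := by simp [hx, hA₁, hA₂, mul_comm]
  have hx0 : x ≠ 0 := by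
    intro h0
    rw [h0] at c0 c1 c2 c3
    simp only [map_zero, Finsupp.coe_zero, Pi.zero_apply, zero_eq_mul, zero_eq_neg, mul_eq_zero]
      at c0 c1 c2 c3
    tauto
  have hQx : hyperboloidForm B x = 0 := by
    rw [hyperboloidForm_apply, c0, c1, c2, c3]
    ring
  have mem_iff : ∀ y, y ∈ tangentPlane (hyperboloidForm B) x ↔ μ * μ' * B.repr y 3 +
      -(ν * ν') * B.repr y 0 + μ * ν' * B.repr y 2 + ν * μ' * B.repr y 1 = 0 := by
    intro y
    rw [tangentPlane, LinearMap.mem_ker, polarBilin_hyperboloidForm, c0, c1, c2, c3]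
  have hA₁T : A₁ ∈ tangentPlane (hyperboloidForm B) x := by
    rw [mem_iff]
    simp [hA₁]
    ring
  have hA₂T : A₂ ∈ tangentPlane (hyperboloidForm B) x := by
    rw [mem_iff]
    simp [hA₂]
    ring
  have hC₁T : C₁ ∈ tangentPlane (hyperboloidForm B) x := by
    rw [mem_iff]
    simp [hC₁]
    ring
  have hC₂T : C₂ ∈ tangentPlane (hyperboloidForm B) x := by
    rw [mem_iff]
    simp [hC₂]
    ring
  -- A line through `x` that is spanned by two tangent points belongs to the pencil.
  have key : ∀ r s : ℝ, ∀ X Y : PointSpace, x = r • X + s • Y → (r ≠ 0 ∨ s ≠ 0) →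
      X ∈ tangentPlane (hyperboloidForm B) x → Y ∈ tangentPlane (hyperboloidForm B) x →
      pluckerJoin X Y ∈ contactElement x (tangentPlane (hyperboloidForm B) x) := by
    intro r s X Y hxXY hrs hX hY
    have e1 : pluckerJoin x Y = r • pluckerJoin X Y := by simp [hxXY, pluckerJoin_self]
    have e2 : pluckerJoin x X = -s • pluckerJoin X Y := by
      simp [hxXY, pluckerJoin_self, pluckerJoin_comm X Y]
    rcases hrs with hr | hs
    · rw [← smul_mem_iff _ hr, ← e1]
      exact mem_map_of_mem hY
    · rw [← smul_mem_iff _ (neg_ne_zero.2 hs), ← e2]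
      exact mem_map_of_mem hX
  refine ⟨x, hx0, hQx, eq_of_le_of_finrank_le ?_ ?_⟩
  · rw [h, span_le]
    rintro p (rfl | rfl)
    · exact smul_mem _ _ (key _ _ _ _ hx hμ' hA₁T hA₂T)
    · exact smul_mem _ _ (key _ _ _ _ hx' hμ hC₁T hC₂T)
  · have hT : finrank ℝ (tangentPlane (hyperboloidForm B) x) ≤ 3 := by
      have hne : tangentPlane (hyperboloidForm B) x ≠ ⊤ := by
        intro htop
        have hmem : ∀ k, B k ∈ tangentPlane (hyperboloidForm B) x := fun k => htop ▸ mem_top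
        have h0 := (mem_iff _).1 (hmem 0)
        have h1 := (mem_iff _).1 (hmem 1)
        have h2 := (mem_iff _).1 (hmem 2)
        have h3 := (mem_iff _).1 (hmem 3)
        simp at h0 h1 h2 h3
        tauto
      have := finrank_lt hne
      rw [finrank_fin_fun] at this
      omega
    have hxT : x ∈ tangentPlane (hyperboloidForm B) x := by
      rw [hx]
      exact add_mem (smul_mem _ _ hA₁T) (smul_mem _ _ hA₂T)
    have hrank := LinearMap.finrank_range_add_finrank_ker
      ((pluckerJoin x).domRestrict (tangentPlane (hyperboloidForm B) x))
    have hker : 1 ≤ finrank ℝ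
        (LinearMap.ker ((pluckerJoin x).domRestrict (tangentPlane (hyperboloidForm B) x))) :=
      one_le_finrank_iff.2 ((Submodule.ne_bot_iff _).2
        ⟨⟨x, hxT⟩, pluckerJoin_self x, fun h0 => hx0 (congrArg Subtype.val h0)⟩)
    rw [LinearMap.range_domRestrict] at hrank
    rw [hL, contactElement]
    omega

/-! ### The hyperboloid of a generic congruence -/

theorem pluckerBilin_eq_zero_of_smul {q p e₁ e₂ r : PluckerSpace} {c s t : ℝ} (hc : c ≠ 0)
    (h : p = s • e₁ + c • r + t • e₂) (hp : pluckerBilin q p = 0) (h₁ : pluckerBilin q e₁ = 0)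
    (h₂ : pluckerBilin q e₂ = 0) : pluckerBilin q r = 0 := by
  rw [h] at hp
  simpa [h₁, h₂, hc] using hp

/-- Two families of points of the Plücker quadric that are conjugate to each other, with three
pairwise non-conjugate points in each of them, are complementary reguli of a hyperboloid. -/
theorem exists_basis_regulus {a b : ℤ → PluckerSpace} (ha : ∀ j, pluckerForm (a j) = 0)
    (hb : ∀ i, pluckerForm (b i) = 0) (hab : ∀ i j, pluckerBilin (b i) (a j) = 0)
    (ha₀₁ : pluckerBilin (a 0) (a 1) ≠ 0) (ha₂₀ : pluckerBilin (a 2) (a 0) ≠ 0)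
    (ha₂₁ : pluckerBilin (a 2) (a 1) ≠ 0) (hb₀₁ : pluckerBilin (b 0) (b 1) ≠ 0)
    (hb₂₀ : pluckerBilin (b 2) (b 0) ≠ 0) (hb₂₁ : pluckerBilin (b 2) (b 1) ≠ 0) :
    ∃ B : Basis (Fin 4) ℝ PointSpace,
      (∀ j, ∃ c μ ν : ℝ, (μ ≠ 0 ∨ ν ≠ 0) ∧
        a j = c • pluckerJoin (μ • B 0 + ν • B 2) (μ • B 1 - ν • B 3)) ∧
      ∀ i, ∃ c μ ν : ℝ, (μ ≠ 0 ∨ ν ≠ 0) ∧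
        b i = c • pluckerJoin (μ • B 0 + ν • B 1) (μ • B 2 - ν • B 3) := by
  have hba : ∀ i j, pluckerBilin (a j) (b i) = 0 := fun i j => by rw [pluckerBilin_comm, hab]
  obtain ⟨f, c, d, hf01, hf23, hf02, hf13, hD⟩ := exists_tetrahedron (ha 0) (ha 1) (hb 0) (hb 1)
    (hab 0 0) (hab 0 1) (hab 1 0) (hab 1 1) ha₀₁ hb₀₁
  have hc : c ≠ 0 := by
    rintro rfl
    exact hD (by rw [hf01, zero_smul, map_zero, LinearMap.zero_apply])
  have hd : d ≠ 0 := by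
    rintro rfl
    exact hD (by rw [hf23, zero_smul, map_zero])
  obtain ⟨s, α, β, t, ha2, hα, hβ⟩ := exists_edge_coordinates_ne_zero hD (ha 2)
    (by rw [hf02, hba]) (by rw [hf13, hba])
    (by rw [hf01, map_smul, smul_eq_mul]; exact mul_ne_zero hc ha₂₀)
    (by rw [hf23, map_smul, smul_eq_mul]; exact mul_ne_zero hd ha₂₁)
  -- Rescaling two vertices makes both coordinates `α` and `β` equal to one.
  let g : Fin 4 → PointSpace := ![f 0, f 1, β • f 2, α • f 3]
  have hg01 : pluckerJoin (g 0) (g 1) = c • a 0 := hf01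
  have hg23 : pluckerJoin (g 2) (g 3) = (β * α * d) • a 1 := by
    simp [g, hf23, smul_smul]
    ring_nf
  have hg02 : pluckerJoin (g 0) (g 2) = β • b 0 := by simp [g, hf02]
  have hg13 : pluckerJoin (g 1) (g 3) = α • b 1 := by simp [g, hf13]
  have hgD : pluckerBilin (pluckerJoin (g 0) (g 1)) (pluckerJoin (g 2) (g 3)) ≠ 0 := by
    rw [hg01, hg23]
    simp [hc, hd, hα, hβ, ha₀₁]
  have hgD' : pluckerBilin (pluckerJoin (g 0) (g 2)) (pluckerJoin (g 1) (g 3)) ≠ 0 := by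
    rw [hg02, hg13]
    simp [hα, hβ, hb₀₁]
  have ha2' : a 2 = s • pluckerJoin (f 0) (f 1) +
      (1 : ℝ) • (pluckerJoin (g 0) (g 3) - pluckerJoin (g 2) (g 1)) +
      t • pluckerJoin (f 2) (f 3) := by
    rw [ha2, pluckerJoin_comm (g 1) (g 2)]
    simp [g]
    abel
  have hbw : ∀ i, pluckerBilin (b i) (pluckerJoin (g 0) (g 3) - pluckerJoin (g 2) (g 1)) = 0 :=
    fun i => pluckerBilin_eq_zero_of_smul one_ne_zero ha2' (hab i 2)
      (by rw [hf01, map_smul, hab, smul_zero]) (by rw [hf23, map_smul, hab, smul_zero])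
  have hb01 : ∀ i, pluckerBilin (b i) (pluckerJoin (g 0) (g 1)) = 0 := fun i => by
    rw [hg01, map_smul, hab, smul_zero]
  have hb23 : ∀ i, pluckerBilin (b i) (pluckerJoin (g 2) (g 3)) = 0 := fun i => by
    rw [hg23, map_smul, hab, smul_zero]
  have ha02 : ∀ j, pluckerBilin (a j) (pluckerJoin (g 0) (g 2)) = 0 := fun j => by
    rw [hg02, map_smul, hba, smul_zero]
  have ha13 : ∀ j, pluckerBilin (a j) (pluckerJoin (g 1) (g 3)) = 0 := fun j => by
    rw [hg13, map_smul, hba, smul_zero]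
  obtain ⟨s', α', β', t', hb2, hα', -⟩ := exists_edge_coordinates_ne_zero hgD' (hb 2) (hb01 2)
    (hb23 2) (by rw [hg02, map_smul, smul_eq_mul]; exact mul_ne_zero hβ hb₂₀)
    (by rw [hg13, map_smul, smul_eq_mul]; exact mul_ne_zero hα hb₂₁)
  -- Conjugacy of `b 2` and `a 2` forces opposite signs on the two edges.
  have hβ' : β' = α' := by
    have h0 := hbw 2
    rw [hb2] at h0
    simp only [map_add, map_sub, map_smul, LinearMap.add_apply, LinearMap.smul_apply, smul_eq_mul,
      pluckerBilin_pluckerJoin_left, pluckerBilin_pluckerJoin_right, pluckerBilin_pluckerJoin_mid,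
      pluckerBilin_pluckerJoin_mid', mul_zero, zero_add, add_zero,
      pluckerBilin_pluckerJoin_rotate (g 0) (g 2) (g 1) (g 3),
      pluckerBilin_comm (pluckerJoin (g 2) (g 1)) (pluckerJoin (g 0) (g 3))] at h0
    refine sub_eq_zero.1 ((mul_eq_zero.1 ?_).resolve_right hgD')
    linear_combination h0
  have hb2' : b 2 = s' • pluckerJoin (g 0) (g 2) +
      α' • (pluckerJoin (g 0) (g 3) - pluckerJoin (g 1) (g 2)) +
      t' • pluckerJoin (g 1) (g 3) := by
    rw [hb2, hβ', pluckerJoin_comm (g 1) (g 2)]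
    module
  have haw : ∀ j, pluckerBilin (a j) (pluckerJoin (g 0) (g 3) - pluckerJoin (g 1) (g 2)) = 0 :=
    fun j => pluckerBilin_eq_zero_of_smul hα' hb2' (hba 2 j) (ha02 j) (ha13 j)
  have hB : ∀ k, basisOfLinearIndependentOfCardEqFinrank
      (linearIndependent_of_pluckerBilin_ne_zero hgD) (by simp) k = g k := fun k => by simp
  refine ⟨basisOfLinearIndependentOfCardEqFinrank
    (linearIndependent_of_pluckerBilin_ne_zero hgD) (by simp), fun j => ?_, fun i => ?_⟩
  · simp only [hB]
    exact exists_regulus_parameter hgD (ha j) (ha02 j) (ha13 j) (haw j)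
  · simp only [hB]
    exact exists_regulus_parameter hgD' (hb i) (hb01 i) (hb23 i) (hbw i)

theorem mainTheorem11 (l : ℤ → ℤ → Submodule ℝ PluckerSpace)
    (hl : IsIsotropicMultiLineCongruence l) (hgen : IsGenericLineFamily l) :
    ∃ Q : QuadraticForm ℝ PointSpace, IsHyperboloid Q ∧ ∀ i j, IsContactElementOf Q (l i j) := by
  have h : IsGenericCongruence l := ⟨hl, hgen⟩
  choose a ha0 ha using h.exists_vertex
  choose b hb0 hb using h.swap.exists_vertex
  have ha' : ∀ i j, a j ∈ l i j := fun i j => ha j i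
  have hane : ∀ s : Fin 5 → ℤ, s.Injective → pluckerBilin (a (s 0)) (a (s 1)) ≠ 0 :=
    fun s => h.pluckerBilin_ne_zero ha0 ha' hb0 hb
  have hbne : ∀ s : Fin 5 → ℤ, s.Injective → pluckerBilin (b (s 0)) (b (s 1)) ≠ 0 :=
    fun s => h.swap.pluckerBilin_ne_zero hb0 (fun i j => hb j i) ha0 (fun i j => ha' j i)
  obtain ⟨B, hBa, hBb⟩ := exists_basis_regulus (a := a) (b := b)
    (fun j => (hl.isotropic 0 j).2 _ (ha' 0 j)) (fun i => (hl.isotropic i 0).2 _ (hb i 0))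
    (h.pluckerBilin_eq_zero ha' hb)
    (hane ![0, 1, 2, 3, 4] (by decide)) (hane ![2, 0, 1, 3, 4] (by decide))
    (hane ![2, 1, 0, 3, 4] (by decide)) (hbne ![0, 1, 2, 3, 4] (by decide))
    (hbne ![2, 0, 1, 3, 4] (by decide)) (hbne ![2, 1, 0, 3, 4] (by decide))
  refine ⟨hyperboloidForm B, isHyperboloid_hyperboloidForm B, fun i j => ?_⟩
  obtain ⟨c, μ, ν, hμ, hc⟩ := hBa j
  obtain ⟨d, μ', ν', hμ', hd⟩ := hBb i
  refine isContactElementOf_hyperboloidForm B (hl.isotropic i j).1 hμ hμ' (c := c) (d := d) ?_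
  rw [← hc, ← hd, Set.pair_comm]
  exact h.line_eq_span (hb0 i) (ha' i j) (hb i j)
    (h.notMem_span_singleton ha0 ha' hb0 hb i j)
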